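/- Let $\Gamma$ be a groupoid, i.e. a small category in which every morphism is an isomorphism, with set of objects $\Gamma_0$; for a morphism $\gamma$ write $d(\gamma)$ for its domain and $r(\gamma)$ for its range, and identify each $e\in\Gamma_0$ with its identity morphism. The product $\gamma\delta$ is defined when $d(\gamma)=r(\delta)$. Let $R$ be an associative, not necessarily unital ring that is $\Gamma$-graded and object unital: $R=\bigoplus_{\gamma\in\Gamma}R_\gamma$ for additive subgroups $R_\gamma$ with $R_\gamma R_\delta\subseteq R_{\gamma\delta}$ if $\gamma\delta$ is defined and $R_\gamma R_\delta=0$ otherwise, and for each $e\in\Gamma_0$ the ring $R_e$ has an identity element $1_e$ such that $1_{r(\gamma)}a=a=a1_{d(\gamma)}$ for all $\gamma\in\Gamma$ and $a\in R_\gamma$. A graded right ideal of $R$ is a right ideal $U$ with $U=\bigoplus_{\gamma}(U\cap R_\gamma)$. It is gr-maximal if it is maximal among the graded right ideals different from $R$, and gr-simple if it is minimal among the nonzero graded right ideals. The ring $R$ is gr-semisimple if it is the sum of its gr-simple graded right ideals. The graded Jacobson radical $\mathrm{rad}^{\mathrm{gr}}(R)$ is the intersection of all gr-maximal graded right ideals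 of $R$ (and is $R$ if there are none); it is a graded two-sided ideal. The ring $R$ is gr-semilocal if the graded ring $R/\mathrm{rad}^{\mathrm{gr}}(R)$, with components $(R_\gamma+\mathrm{rad}^{\mathrm{gr}}(R))/\mathrm{rad}^{\mathrm{gr}}(R)$, is gr-semisimple. For $e\in\Gamma_0$ the ring $1_eR1_e$ is $\Gamma$-graded with components $1_eR1_e\cap R_\gamma$. A unital ring $A$ is semilocal if $A/\mathrm{rad}(A)$ is semisimple, where $\mathrm{rad}(A)$ is its Jacobson radical; the zero ring is semilocal. Then the following assertions are equivalent: 1. $R$ is a gr-semilocal ring. 2. $1_eR1_e$ is a gr-semilocal ring for every $e\in\Gamma_0$. 3. $R_e$ is a semilocal ring for every $e\in\Gamma_0$. -/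

import Mathlib

open CategoryTheory

universe u v w

section Internal

/-! ### Helper facts on internal direct sums of additive subgroups -/

theorem isInternal_of_iSupIndep_of_iSup {ι M : Type*} [DecidableEq ι] [AddCommGroup M] {A : ι → AddSubgroup M}
    (hi : iSupIndep A) (hs : ∀ x : M, x ∈ iSup A) : DirectSum.IsInternal A := by
  refine ⟨iSupIndep.dfinsuppSumAddHom_injective hi, fun x => ?_⟩
  change x ∈ (DirectSum.coeAddMonoidHom A).range
  refine AddSubgroup.iSup_induction A (C := fun x => x ∈ (DirectSum.coeAddMonoidHom A).range)
    (hs x) (fun i y hy => ⟨DirectSum.of (fun i => A i) i ⟨y, hy⟩, by simp⟩) (zero_mem _)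
    (fun y z => add_mem)

end Internal

/-- An object unital grading of the (not necessarily unital) ring `R` by the groupoid `Γ`.
A morphism `γ : x ⟶ y` has domain `d(γ) = x` and range `r(γ) = y`; the product `σ τ` of the
groupoid, defined when `d(σ) = r(τ)`, is `τ ≫ σ`. The identity element of the ring `R_e` is
`one e`; it is determined by the homogeneous components. -/
structure GroupoidGrading (Γ : Type u) [Groupoid.{v} Γ] (R : Type w) [NonUnitalRing R] where
  /-- The homogeneous component `R_γ`. -/
  component : ∀ {x y : Γ}, (x ⟶ y) → AddSubgroup R
  /-- `R` is the (internal) direct sum of the homogeneous components. -/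
  isInternal : open Classical in
    DirectSum.IsInternal (fun γ : (Σ x : Γ, Σ y : Γ, (x ⟶ y)) => component γ.2.2)
  mul_mem : ∀ {x y z : Γ} (σ : y ⟶ z) (τ : x ⟶ y) {a b : R},
    a ∈ component σ → b ∈ component τ → a * b ∈ component (τ ≫ σ)
  mul_eq_zero : ∀ {w x y z : Γ} (σ : y ⟶ z) (τ : w ⟶ x) {a b : R}, y ≠ x →
    a ∈ component σ → b ∈ component τ → a * b = 0
  /-- The element `1_e` of `R_e`. -/
  one : Γ → R
  one_mem : ∀ e : Γ, one e ∈ component (𝟙 e)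
  one_mul : ∀ {x y : Γ} (γ : x ⟶ y) {a : R}, a ∈ component γ → one y * a = a
  mul_one : ∀ {x y : Γ} (γ : x ⟶ y) {a : R}, a ∈ component γ → a * one x = a

namespace GroupoidGrading

variable {Γ : Type u} [Groupoid.{v} Γ] {R : Type w} [NonUnitalRing R] (G : GroupoidGrading Γ R)

/-- The homogeneous component of a degree in the set of all morphisms of `Γ`. -/
abbrev comp (γ : Σ x : Γ, Σ y : Γ, (x ⟶ y)) : AddSubgroup R := G.component γ.2.2

/-! ### Graded right ideals, gr-maximality, gr-simplicity -/

/-- A subgroup `U` of `R` is graded if `U = ⨁ (U ∩ R_γ)` (the sum is automatically direct). -/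
def IsGraded (U : AddSubgroup R) : Prop :=
  U = ⨆ γ, U ⊓ G.comp γ

/-- Graded right ideals of `R`, that is, graded submodules of `R_R`. -/
structure IsGradedRightIdeal (U : AddSubgroup R) : Prop where
  mul_mem_right : ∀ {a : R} (r : R), a ∈ U → a * r ∈ U
  isGraded : G.IsGraded U

/-- A gr-maximal graded right ideal: maximal among the graded right ideals different from `R`. -/
def IsGrMaximal (U : AddSubgroup R) : Prop :=
  Maximal (fun X => G.IsGradedRightIdeal X ∧ X ≠ ⊤) U

/-- A gr-simple graded right ideal: minimal among the nonzero graded right ideals. -/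
def IsGrSimple (U : AddSubgroup R) : Prop :=
  Minimal (fun X => G.IsGradedRightIdeal X ∧ X ≠ ⊥) U

/-- The graded ring `R` is gr-semisimple: `R_R` is the sum of its gr-simple graded submodules. -/
def IsGrSemisimple : Prop :=
  sSup {U : AddSubgroup R | G.IsGrSimple U} = ⊤

/-- The graded Jacobson radical as an additive subgroup: the intersection of all gr-maximal graded
right ideals (it is `R` if there are none). -/
def grRadSubgroup : AddSubgroup R :=
  sInf {U : AddSubgroup R | G.IsGrMaximal U}

/-! ### Projections on the homogeneous components -/

open Classical in
/-- The projection sending `a` to its homogeneous component `a_γ`. -/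
noncomputable def proj (γ : Σ x : Γ, Σ y : Γ, (x ⟶ y)) : R →+ R :=
  (G.comp γ).subtype.comp
    ((DFinsupp.evalAddMonoidHom γ).comp
      (AddEquiv.ofBijective (DirectSum.coeAddMonoidHom G.comp) G.isInternal).symm.toAddMonoidHom)

theorem iSup_comp_mem (a : R) : a ∈ ⨆ γ, G.comp γ := by
  classical
  obtain ⟨x, rfl⟩ := G.isInternal.2 a
  rw [DirectSum.coeAddMonoidHom_eq_dfinsuppSum]
  exact sum_mem fun γ _ => AddSubgroup.mem_iSup_of_mem (S := G.comp) γ (x γ).2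

theorem induction_on {C : R → Prop} (a : R)
    (mem : ∀ {x y : Γ} (γ : x ⟶ y), ∀ b ∈ G.component γ, C b) (zero : C 0)
    (add : ∀ b c, C b → C c → C (b + c)) : C a :=
  AddSubgroup.iSup_induction G.comp (C := C) (G.iSup_comp_mem a) (fun γ b hb => mem γ.2.2 b hb) zero add

theorem proj_mem (γ) (a : R) : G.proj γ a ∈ G.comp γ := by
  classical
  exact ((AddEquiv.ofBijective (DirectSum.coeAddMonoidHom G.comp) G.isInternal).symm a γ).2

theorem proj_same {γ} {a : R} (ha : a ∈ G.comp γ) : G.proj γ a = a := by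
  classical
  have : (AddEquiv.ofBijective (DirectSum.coeAddMonoidHom G.comp) G.isInternal).symm a
      = DirectSum.of (fun γ => G.comp γ) γ ⟨a, ha⟩ := by
    rw [AddEquiv.symm_apply_eq]
    exact (DirectSum.coeAddMonoidHom_of G.comp γ ⟨a, ha⟩).symm
  change (((AddEquiv.ofBijective (DirectSum.coeAddMonoidHom G.comp) G.isInternal).symm a) γ : R) = a
  rw [this]
  exact congrArg Subtype.val (DirectSum.of_eq_same (β := fun γ => G.comp γ) γ ⟨a, ha⟩)

theorem proj_ne {γ δ} (h : γ ≠ δ) {a : R} (ha : a ∈ G.comp γ) : G.proj δ a = 0 := by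
  classical
  have : (AddEquiv.ofBijective (DirectSum.coeAddMonoidHom G.comp) G.isInternal).symm a
      = DirectSum.of (fun γ => G.comp γ) γ ⟨a, ha⟩ := by
    rw [AddEquiv.symm_apply_eq]
    exact (DirectSum.coeAddMonoidHom_of G.comp γ ⟨a, ha⟩).symm
  change (((AddEquiv.ofBijective (DirectSum.coeAddMonoidHom G.comp) G.isInternal).symm a) δ : R) = 0
  rw [this]
  exact congrArg Subtype.val (DirectSum.of_eq_of_ne (β := fun γ => G.comp γ) γ δ ⟨a, ha⟩ h.symm)

theorem mem_iSup_of_proj_mem {U : AddSubgroup R} {a : R} (h : ∀ γ, G.proj γ a ∈ U) :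
    a ∈ ⨆ γ, U ⊓ G.comp γ := by
  classical
  set x := (AddEquiv.ofBijective (DirectSum.coeAddMonoidHom G.comp) G.isInternal).symm a with hx
  have hxa : DirectSum.coeAddMonoidHom G.comp x = a :=
    (AddEquiv.ofBijective (DirectSum.coeAddMonoidHom G.comp) G.isInternal).apply_symm_apply a
  rw [← hxa, DirectSum.coeAddMonoidHom_eq_dfinsuppSum]
  exact sum_mem fun γ _ => AddSubgroup.mem_iSup_of_mem (S := fun γ => U ⊓ G.comp γ) γ
    ⟨h γ, (x γ).2⟩

theorem isGraded_of_le {U : AddSubgroup R} (h : U ≤ ⨆ γ, U ⊓ G.comp γ) : G.IsGraded U :=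
  le_antisymm h (iSup_le fun _ => inf_le_left)

theorem isGraded_iff {U : AddSubgroup R} :
    G.IsGraded U ↔ ∀ γ, ∀ a ∈ U, G.proj γ a ∈ U := by
  constructor
  · intro h γ a ha
    rw [h] at ha
    refine AddSubgroup.iSup_induction _ (C := fun a => G.proj γ a ∈ U) ha ?_ (by simp) ?_
    · rintro δ b ⟨hb, hb'⟩
      by_cases hd : δ = γ
      · subst hd; rwa [G.proj_same hb']
      · rw [G.proj_ne hd hb']; exact zero_mem _
    · intro b c hb hc; rw [map_add]; exact add_mem hb hc
  · exact fun h => G.isGraded_of_le fun a ha => G.mem_iSup_of_proj_mem fun γ => h γ a ha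

theorem mul_proj {y z : Γ} (γ : y ⟶ z) {r : R} (hr : r ∈ G.component γ) {x : Γ} (σ : x ⟶ y)
    (a : R) : r * G.proj ⟨x, y, σ⟩ a = G.proj ⟨x, z, σ ≫ γ⟩ (r * a) := by
  refine G.induction_on (C := fun a => r * G.proj ⟨x, y, σ⟩ a = G.proj ⟨x, z, σ ≫ γ⟩ (r * a)) a
    ?_ (by simp) (fun b c hb hc => by simp [mul_add, hb, hc])
  intro x' y' τ b hb
  by_cases hy : y = y'
  · subst hy
    have hrb : r * b ∈ G.comp ⟨x', z, τ ≫ γ⟩ := G.mul_mem γ τ hr hb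
    by_cases hx : (⟨x', y, τ⟩ : Σ x : Γ, Σ y : Γ, (x ⟶ y)) = ⟨x, y, σ⟩
    · obtain ⟨rfl, h⟩ := Sigma.mk.inj hx
      obtain rfl : τ = σ := by simpa using h
      rw [G.proj_same (γ := ⟨_, _, τ⟩) hb, G.proj_same hrb]
    · rw [G.proj_ne (γ := ⟨_, _, τ⟩) hx hb, G.proj_ne _ hrb, mul_zero]
      intro h
      apply hx
      obtain ⟨rfl, h⟩ := Sigma.mk.inj h
      have h' : τ ≫ γ = σ ≫ γ := by simpa using h
      rw [(cancel_mono γ).1 h']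
  · rw [G.mul_eq_zero γ τ hy hr hb, map_zero, G.proj_ne (γ := ⟨_, _, τ⟩) _ hb, mul_zero]
    intro h
    obtain ⟨rfl, h⟩ := Sigma.mk.inj h
    have h := (Sigma.mk.inj (eq_of_heq h)).1
    exact hy h.symm

/-! ### The graded Jacobson radical is a graded two-sided ideal -/

theorem isGraded_grRadSubgroup : G.IsGraded G.grRadSubgroup := by
  rw [isGraded_iff]
  intro γ a ha
  simp only [grRadSubgroup, AddSubgroup.mem_sInf] at ha ⊢
  intro U (hU : G.IsGrMaximal U)
  exact G.isGraded_iff.1 hU.prop.1.isGraded γ a (ha U hU)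

theorem isGradedRightIdeal_colon {m : AddSubgroup R} (hm : G.IsGradedRightIdeal m) {y z : Γ}
    (γ : y ⟶ z) {r : R} (hr : r ∈ G.component γ) :
    G.IsGradedRightIdeal (m.comap (AddMonoidHom.mulLeft r)) := by
  refine ⟨fun {a} s ha => ?_, G.isGraded_iff.2 ?_⟩
  · simp only [AddSubgroup.mem_comap, AddMonoidHom.coe_mulLeft] at ha ⊢
    rw [← mul_assoc]
    exact hm.mul_mem_right s ha
  · rintro ⟨x, y', σ⟩ a ha
    simp only [AddSubgroup.mem_comap, AddMonoidHom.coe_mulLeft] at ha ⊢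
    by_cases hy : y = y'
    · subst hy
      rw [G.mul_proj γ hr]
      exact G.isGraded_iff.1 hm.isGraded _ _ ha
    · rw [G.mul_eq_zero γ σ hy hr (G.proj_mem ⟨x, y', σ⟩ a)]
      exact zero_mem _

theorem isGradedRightIdeal_sup_mul {m : AddSubgroup R} (hm : G.IsGradedRightIdeal m) {y z : Γ}
    (γ : y ⟶ z) {r : R} (hr : r ∈ G.component γ) :
    G.IsGradedRightIdeal (m ⊔ (AddMonoidHom.mulLeft r).range) := by
  refine ⟨fun {a} s ha => ?_, G.isGraded_of_le (sup_le ?_ ?_)⟩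
  · obtain ⟨b, hb, _, ⟨c, rfl⟩, rfl⟩ := AddSubgroup.mem_sup.1 ha
    rw [add_mul]
    refine AddSubgroup.mem_sup.2 ⟨_, hm.mul_mem_right s hb, _, ⟨c * s, rfl⟩, ?_⟩
    simp [mul_assoc]
  · conv_lhs => rw [hm.isGraded]
    exact iSup_mono fun δ => inf_le_inf_right _ le_sup_left
  · rintro _ ⟨c, rfl⟩
    refine G.induction_on (C := fun c => AddMonoidHom.mulLeft r c ∈ ⨆ δ,
      (m ⊔ (AddMonoidHom.mulLeft r).range) ⊓ G.comp δ) c ?_ (by simp) (fun b c hb hc => by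
      rw [map_add]; exact add_mem hb hc)
    intro x y' τ b hb
    by_cases hy : y = y'
    · subst hy
      exact AddSubgroup.mem_iSup_of_mem (S := fun δ => _ ⊓ G.comp δ) ⟨x, z, τ ≫ γ⟩
        ⟨AddSubgroup.mem_sup_right ⟨b, rfl⟩, G.mul_mem γ τ hr hb⟩
    · rw [AddMonoidHom.coe_mulLeft, G.mul_eq_zero γ τ hy hr hb]
      exact zero_mem _

theorem isGrMaximal_colon {m : AddSubgroup R} (hm : G.IsGrMaximal m) {y z : Γ}
    (γ : y ⟶ z) {r : R} (hr : r ∈ G.component γ) (hrm : r ∉ m) :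
    G.IsGrMaximal (m.comap (AddMonoidHom.mulLeft r)) := by
  refine ⟨⟨G.isGradedRightIdeal_colon hm.prop.1 γ hr, ?_⟩, ?_⟩
  · intro h
    apply hrm
    have : G.one y ∈ m.comap (AddMonoidHom.mulLeft r) := h ▸ AddSubgroup.mem_top _
    simpa [G.mul_one γ hr] using this
  · rintro U ⟨hU, hUtop⟩ hle
    by_contra hnot
    apply hUtop
    -- a homogeneous element `u` of `U` with `r * u ∉ m`
    obtain ⟨x, τ, u, huU, huτ, hum⟩ : ∃ (x : Γ) (τ : x ⟶ y) (u : R), u ∈ U ∧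
        u ∈ G.component τ ∧ r * u ∉ m := by
      by_contra hcon
      push Not at hcon
      apply hnot
      rw [hU.isGraded]
      refine iSup_le ?_
      rintro ⟨x, y', τ⟩ u ⟨hu, hu'⟩
      simp only [AddSubgroup.mem_comap, AddMonoidHom.coe_mulLeft]
      by_cases hy : y = y'
      · subst hy; exact hcon x τ u hu hu'
      · rw [G.mul_eq_zero γ τ hy hr hu']; exact zero_mem _
    have hru : r * u ∈ G.component (τ ≫ γ) := G.mul_mem γ τ hr huτ
    have htop : m ⊔ (AddMonoidHom.mulLeft (r * u)).range = ⊤ := by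
      by_contra hne
      have := hm.le_of_ge ⟨G.isGradedRightIdeal_sup_mul hm.prop.1 _ hru, hne⟩ le_sup_left
      exact hum (this (AddSubgroup.mem_sup_right ⟨G.one x, G.mul_one _ hru⟩))
    have hr' : r ∈ m ⊔ (AddMonoidHom.mulLeft (r * u)).range := htop ▸ AddSubgroup.mem_top _
    obtain ⟨b, hb, _, ⟨s, rfl⟩, hbs⟩ := AddSubgroup.mem_sup.1 hr'
    simp only [AddMonoidHom.coe_mulLeft] at hbs
    have h1 : G.one y - u * s ∈ U := by
      apply hle
      simp only [AddSubgroup.mem_comap, AddMonoidHom.coe_mulLeft, mul_sub, G.mul_one γ hr]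
      have : b = r - r * (u * s) := by rw [← mul_assoc]; exact eq_sub_of_add_eq hbs
      rwa [← this]
    have h2 : G.one y ∈ U := by
      simpa using add_mem h1 (hU.mul_mem_right s huU)
    rw [eq_top_iff]
    intro a _
    have h3 : a - G.one y * a ∈ U := by
      apply hle
      simp only [AddSubgroup.mem_comap, AddMonoidHom.coe_mulLeft, mul_sub]
      rw [← mul_assoc, G.mul_one γ hr, sub_self]
      exact zero_mem _
    simpa using add_mem h3 (hU.mul_mem_right a h2)

theorem grRadSubgroup_mul_mem_right {a : R} (r : R) (ha : a ∈ G.grRadSubgroup) :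
    a * r ∈ G.grRadSubgroup := by
  simp only [grRadSubgroup, AddSubgroup.mem_sInf] at ha ⊢
  intro U (hU : G.IsGrMaximal U)
  exact hU.prop.1.mul_mem_right r (ha U hU)

theorem grRadSubgroup_mul_mem_left (r : R) {a : R} (ha : a ∈ G.grRadSubgroup) :
    r * a ∈ G.grRadSubgroup := by
  refine G.induction_on (C := fun r => r * a ∈ G.grRadSubgroup) r ?_ (by simp) (fun b c hb hc => by rw [add_mul]; exact add_mem hb hc)
  intro y z γ r hr
  simp only [grRadSubgroup, AddSubgroup.mem_sInf] at ha ⊢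
  intro m (hm : G.IsGrMaximal m)
  by_cases hrm : r ∈ m
  · exact hm.prop.1.mul_mem_right a hrm
  · exact ha _ (G.isGrMaximal_colon hm γ hr hrm)

/-- The graded Jacobson radical of `R`, a graded two-sided ideal: the intersection of all gr-maximal
graded right ideals of `R`. -/
def grRad : TwoSidedIdeal R :=
  TwoSidedIdeal.mk' (G.grRadSubgroup : Set R) (zero_mem _) add_mem neg_mem
    (fun {r _} ha => G.grRadSubgroup_mul_mem_left r ha)
    (fun {_ r} ha => G.grRadSubgroup_mul_mem_right r ha)

/-- A two-sided ideal is graded if its underlying subgroup is. -/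
def IsGradedIdeal (I : TwoSidedIdeal R) : Prop :=
  G.IsGraded (TwoSidedIdeal.coeAddMonoidHom I).range

theorem mem_range_coe {I : TwoSidedIdeal R} {a : R} :
    a ∈ (TwoSidedIdeal.coeAddMonoidHom I).range ↔ a ∈ I :=
  ⟨by rintro ⟨b, rfl⟩; exact b.2, fun h => ⟨⟨a, h⟩, rfl⟩⟩

theorem isGradedIdeal_grRad : G.IsGradedIdeal G.grRad := by
  have : (TwoSidedIdeal.coeAddMonoidHom G.grRad).range = G.grRadSubgroup := by
    ext a
    rw [mem_range_coe, grRad, TwoSidedIdeal.mem_mk', SetLike.mem_coe]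
  rw [IsGradedIdeal, this]
  exact G.isGraded_grRadSubgroup

theorem proj_eq_zero_of_mem_iSup {γ} {a : R} (ha : a ∈ ⨆ δ, ⨆ (_ : δ ≠ γ), G.comp δ) :
    G.proj γ a = 0 := by
  have : ⨆ δ, ⨆ (_ : δ ≠ γ), G.comp δ ≤ (G.proj γ).ker :=
    iSup_le fun δ => iSup_le fun h b hb => G.proj_ne h hb
  exact this ha

/-! ### Quotients, corners and the rings `R_e` -/

/-- The quotient map `R → R/I` as a homomorphism of additive groups. -/
def quotientMap (I : TwoSidedIdeal R) : R →+ I.ringCon.Quotient where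
  toFun a := (a : I.ringCon.Quotient)
  map_zero' := rfl
  map_add' _ _ := rfl

theorem quotientMap_surjective (I : TwoSidedIdeal R) : Function.Surjective (quotientMap I) :=
  Quotient.mk_surjective

theorem quotientMap_mul (I : TwoSidedIdeal R) (a b : R) :
    quotientMap I (a * b) = quotientMap I a * quotientMap I b := rfl

theorem quotientMap_eq_iff (I : TwoSidedIdeal R) {a b : R} :
    quotientMap I a = quotientMap I b ↔ a - b ∈ I := by
  rw [← TwoSidedIdeal.rel_iff]
  exact RingCon.eq _

/-- The quotient of a `Γ`-graded ring by a graded ideal `I`, with `(R/I)_γ = (R_γ + I)/I`. -/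
def quotient (I : TwoSidedIdeal R) (hI : G.IsGradedIdeal I) :
    GroupoidGrading Γ I.ringCon.Quotient where
  component γ := (G.component γ).map (quotientMap I)
  isInternal := by
    classical
    refine isInternal_of_iSupIndep_of_iSup
      (A := fun γ : (Σ x : Γ, Σ y : Γ, (x ⟶ y)) => (G.comp γ).map (quotientMap I)) ?_ ?_
    · intro γ
      rw [disjoint_iff, eq_bot_iff]
      rintro _ ⟨⟨a, ha, rfl⟩, hb⟩
      simp only [← AddSubgroup.map_iSup] at hb
      obtain ⟨b, hb, hab⟩ := hb
      have h1 := (quotientMap_eq_iff I).1 hab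
      have h2 := G.isGraded_iff.1 hI γ _ (mem_range_coe.2 h1)
      rw [map_sub, G.proj_eq_zero_of_mem_iSup hb, G.proj_same ha, zero_sub] at h2
      have h3 : a - 0 ∈ I := by simpa using neg_mem (mem_range_coe.1 h2)
      rw [AddSubgroup.mem_bot, (quotientMap_eq_iff I).2 h3, map_zero]
    · intro a
      obtain ⟨a, rfl⟩ := quotientMap_surjective I a
      rw [← AddSubgroup.map_iSup]
      exact ⟨a, G.iSup_comp_mem a, rfl⟩
  mul_mem := by
    rintro x y z σ τ _ _ ⟨a, ha, rfl⟩ ⟨b, hb, rfl⟩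
    exact ⟨a * b, G.mul_mem σ τ ha hb, rfl⟩
  mul_eq_zero := by
    rintro w x y z σ τ _ _ h ⟨a, ha, rfl⟩ ⟨b, hb, rfl⟩
    rw [← quotientMap_mul, G.mul_eq_zero σ τ h ha hb, map_zero]
  one e := quotientMap I (G.one e)
  one_mem e := ⟨_, G.one_mem e, rfl⟩
  one_mul := by
    rintro x y γ _ ⟨a, ha, rfl⟩
    rw [← quotientMap_mul, G.one_mul γ ha]
  mul_one := by
    rintro x y γ _ ⟨a, ha, rfl⟩
    rw [← quotientMap_mul, G.mul_one γ ha]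

/-- `R` is gr-semilocal if the graded ring `R/rad^gr(R)` is gr-semisimple. -/
def IsGrSemilocal : Prop :=
  (G.quotient G.grRad G.isGradedIdeal_grRad).IsGrSemisimple

theorem one_mul_one (e : Γ) : G.one e * G.one e = G.one e := G.one_mul _ (G.one_mem e)

theorem mem_corner_iff {e : Γ} {a : R} :
    a ∈ NonUnitalRing.corner (G.one e) ↔ G.one e * a = a ∧ a * G.one e = a :=
  Subsemigroup.mem_corner_iff (G.one_mul_one e)

theorem one_mul_mul_one_mem (e : Γ) {x y : Γ} (γ : x ⟶ y) {a : R} (ha : a ∈ G.component γ) :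
    G.one e * a * G.one e ∈ G.component γ := by
  by_cases hy : e = y
  · subst hy
    rw [G.one_mul γ ha]
    by_cases hx : x = e
    · subst hx
      rwa [G.mul_one γ ha]
    · rw [G.mul_eq_zero γ (𝟙 e) hx ha (G.one_mem e)]; exact zero_mem _
  · rw [G.mul_eq_zero (𝟙 e) γ hy (G.one_mem e) ha, zero_mul]; exact zero_mem _

open Classical in
/-- The ring `1_e R 1_e` with its `Γ`-grading `(1_e R 1_e)_γ = 1_e R 1_e ∩ R_γ`. Thus the component
of degree `γ` is `R_γ` if `γ` is a morphism from `e` to `e`, and zero otherwise. -/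
noncomputable def corner (e : Γ) : GroupoidGrading Γ (NonUnitalRing.corner (G.one e)) where
  component γ := (G.component γ).comap (AddSubmonoidClass.subtype (NonUnitalRing.corner (G.one e)))
  isInternal := by
    classical
    refine isInternal_of_iSupIndep_of_iSup (A := fun γ : (Σ x : Γ, Σ y : Γ, (x ⟶ y)) =>
      (G.comp γ).comap (AddSubmonoidClass.subtype (NonUnitalRing.corner (G.one e)))) ?_ ?_
    · intro γ
      rw [disjoint_iff, eq_bot_iff]
      rintro a ⟨ha, hb⟩
      have hle : (⨆ δ, ⨆ (_ : δ ≠ γ),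
          (G.comp δ).comap (AddSubmonoidClass.subtype (NonUnitalRing.corner (G.one e)))) ≤
          (⨆ δ, ⨆ (_ : δ ≠ γ), G.comp δ).comap
            (AddSubmonoidClass.subtype (NonUnitalRing.corner (G.one e))) :=
        iSup₂_le fun δ h => AddSubgroup.comap_mono (le_iSup₂_of_le δ h le_rfl)
      have h1 := G.proj_eq_zero_of_mem_iSup (hle hb)
      rw [G.proj_same ha] at h1
      exact Subtype.ext h1
    · rintro ⟨_, r, rfl⟩
      refine G.induction_on (C := fun r => (⟨G.one e * r * G.one e, r, rfl⟩ :
        NonUnitalRing.corner (G.one e)) ∈ ⨆ γ : (Σ x : Γ, Σ y : Γ, (x ⟶ y)),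
          (G.comp γ).comap (AddSubmonoidClass.subtype (NonUnitalRing.corner (G.one e)))) r ?_ ?_ ?_
      · intro x y γ b hb
        exact AddSubgroup.mem_iSup_of_mem (S := fun γ : (Σ x : Γ, Σ y : Γ, (x ⟶ y)) =>
          (G.comp γ).comap (AddSubmonoidClass.subtype (NonUnitalRing.corner (G.one e)))) ⟨x, y, γ⟩
          (G.one_mul_mul_one_mem e γ hb)
      · have h0 : (⟨G.one e * 0 * G.one e, 0, rfl⟩ : NonUnitalRing.corner (G.one e)) = 0 :=
          Subtype.ext (by simp)
        rw [h0]
        exact zero_mem _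
      · intro b c hb hc
        convert add_mem hb hc using 1
        exact Subtype.ext (by simp [mul_add, add_mul])
  mul_mem σ τ _ _ ha hb := G.mul_mem σ τ ha hb
  mul_eq_zero σ τ _ _ h ha hb := Subtype.ext (G.mul_eq_zero σ τ h ha hb)
  one f := if f = e then ⟨G.one e, G.mem_corner_iff.2 ⟨G.one_mul_one e, G.one_mul_one e⟩⟩ else 0
  one_mem f := by
    split_ifs with h
    · subst h; exact G.one_mem f
    · exact zero_mem _
  one_mul {x y} γ a ha := by
    split_ifs with h
    · exact Subtype.ext (G.mem_corner_iff.1 a.2).1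
    · have h1 : (a : R) = 0 :=
        (G.mem_corner_iff.1 a.2).1.symm.trans
          (G.mul_eq_zero (𝟙 e) γ (Ne.symm h) (G.one_mem e) ha)
      rw [zero_mul]
      exact Subtype.ext h1.symm
  mul_one {x y} γ a ha := by
    split_ifs with h
    · exact Subtype.ext (G.mem_corner_iff.1 a.2).2
    · have h1 : (a : R) = 0 :=
        (G.mem_corner_iff.1 a.2).2.symm.trans (G.mul_eq_zero γ (𝟙 e) h ha (G.one_mem e))
      rw [mul_zero]
      exact Subtype.ext h1.symm

/-- The subring `R_e`, the homogeneous component whose degree is the identity morphism of `e`. -/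
def objSubring (e : Γ) : NonUnitalSubring R where
  __ := G.component (𝟙 e)
  mul_mem' := by
    intro a b ha hb
    have := G.mul_mem (𝟙 e) (𝟙 e) ha hb
    rwa [Category.comp_id] at this

/-- The ring `R_e`, which is unital with identity element `1_e`. -/
instance instRingObjSubring (e : Γ) : Ring (G.objSubring e) where
  __ : NonUnitalRing (G.objSubring e) := inferInstance
  one := ⟨G.one e, G.one_mem e⟩
  one_mul a := Subtype.ext (G.one_mul (𝟙 e) a.2)
  mul_one a := Subtype.ext (G.mul_one (𝟙 e) a.2)

end GroupoidGrading

/-- A unital ring is semilocal if its quotient by the Jacobson radical is semisimple. -/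
def IsSemilocalRing (A : Type*) [Ring A] : Prop :=
  IsSemisimpleRing (A ⧸ Ring.jacobson A)

/-! Everything reduces to the rings `R_e`. The bridge is `mem_grRadSubgroup_iff`: a homogeneous `a`
of degree `γ : x ⟶ y` lies in `rad^gr(R)` iff `a R_{γ⁻¹}` lies in the Jacobson radical of `R_y`. It
has two consequences for `S = R/rad^gr(R)`: each `S_e` is `R_e/rad(R_e)`, and `S` is nondegenerate,
i.e. a nonzero homogeneous element is not annihilated by the component of inverse degree on its
right.

In any graded ring, a gr-simple right ideal meets each `R_e` in zero or a simple right ideal, so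
gr-semisimplicity passes to every `R_e`. Conversely, in a nondegenerate ring, a nonzero `v` in a
simple right ideal of `R_e` generates a gr-simple right ideal `vR`, so semisimplicity of all `R_e`
lifts. Applied to `S`, this is 1 ⇔ 3 (`isGrSemilocal_iff`). Applied to the corner at `e`, whose
object rings are `R_e` and zero rings, the same equivalence gives 2 ⇔ 3. -/

section RightIdeals

/-! ### Unital rings: the Jacobson radical and semisimplicity seen through right ideals. -/

variable {A : Type*} [Ring A]

/-- Multiplication from the left, as an endomorphism of the right module `A`. -/
def mulLeftRightLinear (y : A) : A →ₗ[Aᵐᵒᵖ] A where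
  toFun a := y * a
  map_add' := mul_add y
  map_smul' s a := by simp [mul_assoc]

/-- Maximal left ideals only yield a left inverse `z` of `1 - j`. But `z = 1 + z * j` has the same
shape, so it also has a left inverse, and `z` is two-sided. -/
theorem exists_mul_eq_one_of_mem_ringJacobson {j : A} (hj : j ∈ Ring.jacobson A) :
    ∃ u, (1 - j) * u = 1 := by
  have key : ∀ k ∈ Ring.jacobson A, ∃ z, z * (1 - k) = 1 := by
    intro k hk
    rw [← Ideal.jacobson_bot] at hk
    obtain ⟨z, hz⟩ := Ideal.mem_jacobson_iff.1 hk (-1)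
    rw [Ideal.mem_bot] at hz
    refine ⟨z, ?_⟩
    rw [← sub_eq_zero, ← hz]
    noncomm_ring
  obtain ⟨z, hz⟩ := key j hj
  obtain ⟨w, hw⟩ := key (-(z * j)) (neg_mem (Ideal.mul_mem_left _ z hj))
  have h1 : 1 - -(z * j) = z := by
    rw [mul_sub, mul_one, sub_eq_iff_eq_add] at hz
    rw [sub_neg_eq_add, ← hz]
  rw [h1] at hw
  exact ⟨z, left_inv_eq_right_inv hw hz ▸ hw⟩

theorem mem_moduleJacobson_op_iff {x : A} :
    x ∈ Module.jacobson Aᵐᵒᵖ A ↔ ∀ n : Submodule Aᵐᵒᵖ A, IsCoatom n → x ∈ n := by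
  simp [Module.jacobson, Submodule.mem_sInf]

theorem one_notMem_of_isCoatom {n : Submodule Aᵐᵒᵖ A} (hn : IsCoatom n) : (1 : A) ∉ n := by
  intro h
  refine hn.1 (eq_top_iff.2 fun a _ => ?_)
  simpa using n.smul_mem (MulOpposite.op a) h

theorem exists_mul_eq_one_of_mem_moduleJacobson_op {k : A} (hk : k ∈ Module.jacobson Aᵐᵒᵖ A) :
    ∃ u, (1 + k) * u = 1 := by
  -- Finite generation puts every proper right ideal inside a maximal one.
  have : Module.Finite Aᵐᵒᵖ A := 
    Module.Finite.of_surjective (LinearMap.toSpanSingleton Aᵐᵒᵖ A 1) fun a =>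
      ⟨MulOpposite.op a, by simp⟩
  have htop : Submodule.span Aᵐᵒᵖ {1 + k} = ⊤ := by
    refine (eq_top_or_exists_le_coatom _).resolve_right ?_
    rintro ⟨n, hn, hle⟩
    refine one_notMem_of_isCoatom hn ?_
    rw [← add_sub_cancel_right (1 : A) k]
    exact sub_mem (hle (Submodule.mem_span_singleton_self _)) (mem_moduleJacobson_op_iff.1 hk n hn)
  obtain ⟨s, hs⟩ := Submodule.mem_span_singleton.1
    (by rw [htop]; trivial : (1 : A) ∈ Submodule.span Aᵐᵒᵖ {1 + k})
  exact ⟨s.unop, by rwa [MulOpposite.smul_eq_mul_unop] at hs⟩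

/-- The Jacobson radical is the intersection of the maximal right ideals. -/
theorem mem_ringJacobson_iff_forall_isCoatom_right {x : A} :
    x ∈ Ring.jacobson A ↔ ∀ n : Submodule Aᵐᵒᵖ A, IsCoatom n → x ∈ n := by
  constructor
  · intro hx n hn
    by_contra hxn
    have h := hn.2 (n ⊔ Submodule.span Aᵐᵒᵖ {x}) (left_lt_sup.2 fun h =>
      hxn (h (Submodule.mem_span_singleton_self x)))
    obtain ⟨m, hm, y, hy, hmy⟩ := Submodule.mem_sup.1 
      (by rw [h]; trivial : (1 : A) ∈ n ⊔ Submodule.span Aᵐᵒᵖ {x})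
    obtain ⟨s, rfl⟩ := Submodule.mem_span_singleton.1 hy
    -- Now `m = 1 - x * s` lies in `n` and is right invertible, which forces `1 ∈ n`.
    obtain ⟨u, hu⟩ := exists_mul_eq_one_of_mem_ringJacobson
      (Ideal.mul_mem_right s.unop (Ring.jacobson A) hx)
    rw [MulOpposite.smul_eq_mul_unop] at hmy
    rw [← eq_sub_of_add_eq hmy] at hu
    have := n.smul_mem (MulOpposite.op u) hm
    rw [op_smul_eq_mul, hu] at this
    exact one_notMem_of_isCoatom hn this
  · intro hx
    have hx' := mem_moduleJacobson_op_iff.2 hx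
    have key (k : A) := exists_mul_eq_one_of_mem_moduleJacobson_op (k := k)
    rw [← Ideal.jacobson_bot, Ideal.mem_jacobson_iff]
    intro y
    have hk : y * x ∈ Module.jacobson Aᵐᵒᵖ A :=
      Module.le_comap_jacobson (mulLeftRightLinear y) hx'
    obtain ⟨u, hu⟩ := key _ hk
    have hk' := neg_mem ((Module.jacobson Aᵐᵒᵖ A).smul_mem (MulOpposite.op u) hk)
    rw [op_smul_eq_mul] at hk'
    obtain ⟨w, hw⟩ := key _ hk'
    -- The right inverse `u` of `1 + y * x` has a right inverse itself, so `u` is two-sided.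
    have h1 : 1 + -(y * x * u) = u := by
      rw [add_mul, one_mul, ← eq_sub_iff_add_eq] at hu; rw [← sub_eq_add_neg, ← hu]
    rw [h1] at hw
    refine ⟨u, ?_⟩
    rw [Ideal.mem_bot, sub_eq_zero, ← hw, ← left_inv_eq_right_inv hu hw]
    noncomm_ring

/-- Right modules detect semisimplicity: `A` is semisimple iff `A` is a sum of simple right
ideals. -/
theorem isSemisimpleRing_iff_sSup_simple_right :
    IsSemisimpleRing A ↔ sSup {n : Submodule Aᵐᵒᵖ A | IsAtom n} = ⊤ := by
  have e : A ≃ₗ[Aᵐᵒᵖ] Aᵐᵒᵖ :=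
    { MulOpposite.opAddEquiv with map_smul' := fun s a => by simp }
  -- Semisimplicity of a ring is left-right symmetric.
  rw [← isSemisimpleRing_mulOpposite_iff, IsSemisimpleRing, ← e.isSemisimpleModule_iff,
    ← sSup_simples_eq_top_iff_isSemisimpleModule]
  simp only [isSimpleModule_iff_isAtom]

end RightIdeals

namespace GroupoidGrading

variable {Γ : Type u} [Groupoid.{v} Γ] {R : Type w} [NonUnitalRing R] (G : GroupoidGrading Γ R)

/-! ### Homogeneous elements and projections onto `R_e`. -/

section Homogeneous

/-- Right multiplication by `r` shifts degrees by `γ ↦ δ ≫ γ`, which is injective because `δ` is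
epi. -/
theorem proj_mul {w x : Γ} (δ : w ⟶ x) {r : R} (hr : r ∈ G.component δ) {y : Γ} (γ : x ⟶ y)
    (a : R) : G.proj ⟨x, y, γ⟩ a * r = G.proj ⟨w, y, δ ≫ γ⟩ (a * r) := by
  refine G.induction_on (C := fun a => G.proj ⟨x, y, γ⟩ a * r = G.proj ⟨w, y, δ ≫ γ⟩ (a * r)) a
    ?_ (by simp) (fun b c hb hc => by simp [add_mul, hb, hc])
  intro x' y' τ b hb
  by_cases hx : x' = x
  · subst hx
    have hbr : b * r ∈ G.comp ⟨w, y', δ ≫ τ⟩ := G.mul_mem τ δ hb hr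
    by_cases hy : (⟨x', y', τ⟩ : Σ x : Γ, Σ y : Γ, (x ⟶ y)) = ⟨x', y, γ⟩
    · have h := eq_of_heq (Sigma.mk.inj hy).2
      obtain ⟨rfl, h⟩ := Sigma.mk.inj h
      obtain rfl := eq_of_heq h
      rw [G.proj_same (γ := ⟨_, _, τ⟩) hb, G.proj_same hbr]
    · rw [G.proj_ne (γ := ⟨_, _, τ⟩) hy hb, G.proj_ne _ hbr, zero_mul]
      intro h
      apply hy
      have h := eq_of_heq (Sigma.mk.inj h).2
      obtain ⟨rfl, h⟩ := Sigma.mk.inj h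
      rw [(cancel_epi δ).1 (eq_of_heq h)]
  · rw [G.mul_eq_zero τ δ hx hb hr, map_zero, G.proj_ne (γ := ⟨_, _, τ⟩) _ hb, zero_mul]
    intro h
    exact hx (Sigma.mk.inj h).1

/-- The projection of `R` on the subring `R_e`. -/
noncomputable def projObj (e : Γ) : R →+ G.objSubring e where
  toFun r := ⟨G.proj ⟨e, e, 𝟙 e⟩ r, G.proj_mem ⟨e, e, 𝟙 e⟩ r⟩
  map_zero' := Subtype.ext (map_zero _)
  map_add' a b := Subtype.ext (map_add _ a b)

theorem coe_projObj (e : Γ) (r : R) : (G.projObj e r : R) = G.proj ⟨e, e, 𝟙 e⟩ r := rfl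

theorem objSubring_coe_one (e : Γ) : ((1 : G.objSubring e) : R) = G.one e := rfl

theorem projObj_coe {e : Γ} (a : G.objSubring e) : G.projObj e a = a :=
  Subtype.ext (G.proj_same (γ := ⟨e, e, 𝟙 e⟩) a.2)

theorem projObj_coe_mul {e : Γ} (a : G.objSubring e) (r : R) :
    G.projObj e (a * r) = a * G.projObj e r := by
  refine Subtype.ext ?_
  have := G.mul_proj (𝟙 e) a.2 (𝟙 e) r
  rw [Category.comp_id] at this
  exact this.symm

theorem projObj_one_mul (e : Γ) (r : R) : G.projObj e (G.one e * r) = G.projObj e r := by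
  have := G.projObj_coe_mul (1 : G.objSubring e) r
  rwa [_root_.one_mul] at this

theorem mul_inv_mem {x y : Γ} {γ : x ⟶ y} {a b : R} (ha : a ∈ G.component γ)
    (hb : b ∈ G.component (Groupoid.inv γ)) : a * b ∈ G.component (𝟙 y) := by
  simpa using G.mul_mem γ (Groupoid.inv γ) ha hb

/-- Only the component of degree `γ⁻¹` can be carried by `a` to an identity degree. -/
theorem coe_projObj_mul {x y : Γ} {γ : x ⟶ y} {a : R} (ha : a ∈ G.component γ) (r : R) :
    (G.projObj y (a * r) : R) = a * G.proj ⟨y, x, Groupoid.inv γ⟩ r := by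
  rw [G.mul_proj γ ha, coe_projObj, Groupoid.inv_comp]

theorem projObj_mul_of_ne {x y e : Γ} (h : y ≠ e) {γ : x ⟶ y} {a : R} (ha : a ∈ G.component γ)
    (r : R) : G.projObj e (a * r) = 0 := by
  rw [← projObj_one_mul, ← mul_assoc, G.mul_eq_zero (𝟙 e) γ h.symm (G.one_mem e) ha, zero_mul,
    map_zero]

variable {G} in
theorem IsGradedRightIdeal.projObj_mem {U : AddSubgroup R} (hU : G.IsGradedRightIdeal U) (e : Γ)
    {a : R} (ha : a ∈ U) : (G.projObj e a : R) ∈ U :=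
  G.isGraded_iff.1 hU.isGraded _ a ha

theorem isGradedRightIdeal_range_mulLeft {x y : Γ} (γ : x ⟶ y) {a : R} (ha : a ∈ G.component γ) :
    G.IsGradedRightIdeal (AddMonoidHom.mulLeft a).range := by
  have hbot : G.IsGradedRightIdeal ⊥ := by
    refine ⟨fun {a} r h => ?_, G.isGraded_of_le bot_le⟩
    rw [AddSubgroup.mem_bot] at h ⊢
    rw [h, zero_mul]
  simpa using G.isGradedRightIdeal_sup_mul hbot γ ha

theorem self_mem_range_mulLeft {x y : Γ} (γ : x ⟶ y) {a : R} (ha : a ∈ G.component γ) :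
    a ∈ (AddMonoidHom.mulLeft a).range :=
  ⟨G.one x, G.mul_one γ ha⟩

theorem IsGradedRightIdeal.range_mulLeft_le {G : GroupoidGrading Γ R} {U : AddSubgroup R}
    (hU : G.IsGradedRightIdeal U) {a : R} (ha : a ∈ U) : (AddMonoidHom.mulLeft a).range ≤ U := by
  rintro _ ⟨r, rfl⟩
  exact hU.mul_mem_right r ha

theorem eq_top_of_one_mem {U : AddSubgroup R} (hU : ∀ {a : R} (r : R), a ∈ U → a * r ∈ U)
    (h : ∀ e, G.one e ∈ U) : U = ⊤ := by
  refine eq_top_iff.2 fun a _ => G.induction_on (C := fun a => a ∈ U) a ?_ (zero_mem _)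
    (fun _ _ => add_mem)
  intro x y γ b hb
  rw [← G.one_mul γ hb]
  exact hU b (h y)

theorem exists_homogeneous_ne_zero {U : AddSubgroup R} (hU : G.IsGraded U) (h : U ≠ ⊥) :
    ∃ (x y : Γ) (γ : x ⟶ y) (a : R), a ∈ U ∧ a ∈ G.component γ ∧ a ≠ 0 := by
  by_contra! hcon
  refine h (eq_bot_iff.2 ?_)
  rw [hU]
  refine iSup_le ?_
  rintro ⟨x, y, γ⟩ a ⟨ha, ha'⟩
  exact hcon x y γ a ha ha'

variable {G} in
/-- The right ideal `U ∩ R_e` of `R_e`. -/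
def IsGradedRightIdeal.restrict {U : AddSubgroup R} (hU : G.IsGradedRightIdeal U) (e : Γ) :
    Submodule (G.objSubring e)ᵐᵒᵖ (G.objSubring e) where
  carrier := {a | (a : R) ∈ U}
  zero_mem' := zero_mem U
  add_mem' ha hb := U.add_mem ha hb
  smul_mem' s _ ha := hU.mul_mem_right (s.unop : R) ha

variable {G} in
theorem IsGradedRightIdeal.mem_restrict {U : AddSubgroup R} (hU : G.IsGradedRightIdeal U) {e : Γ}
    {a : G.objSubring e} : a ∈ hU.restrict e ↔ (a : R) ∈ U := Iff.rfl

end Homogeneous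

/-! ### Gr-semisimplicity versus semisimplicity of the rings `R_e`. -/

section Semisimple

theorem IsGrSimple.range_mulLeft_eq {G : GroupoidGrading Γ R} {U : AddSubgroup R}
    (hU : G.IsGrSimple U) {x y : Γ} {γ : x ⟶ y} {a : R} (ha : a ∈ G.component γ) (haU : a ∈ U)
    (h0 : a ≠ 0) : (AddMonoidHom.mulLeft a).range = U := by
  refine hU.eq_of_le ⟨G.isGradedRightIdeal_range_mulLeft γ ha, fun h => h0 ?_⟩
    (hU.prop.1.range_mulLeft_le haU)
  have := G.self_mem_range_mulLeft γ ha
  rwa [h] at this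

/-- Any nonzero `v ∈ U ∩ R_e` satisfies `U = vR`; taking components in `R_e` gives `U ∩ R_e = vR_e`.
-/
theorem IsGrSimple.isAtom_restrict {G : GroupoidGrading Γ R} {U : AddSubgroup R}
    (hU : G.IsGrSimple U) {e : Γ} (h : hU.prop.1.restrict e ≠ ⊥) :
    IsAtom (hU.prop.1.restrict e) := by
  refine ⟨h, fun V hV => ?_⟩
  by_contra hV0
  obtain ⟨v, hv, hv0⟩ := V.exists_mem_ne_zero_of_ne_bot hV0
  refine hV.not_ge fun u hu => ?_
  have hvU : (v : R) ∈ U := hU.prop.1.mem_restrict.1 (hV.le hv)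
  have hu' : (u : R) ∈ U := hU.prop.1.mem_restrict.1 hu
  rw [← hU.range_mulLeft_eq v.2 hvU (fun h => hv0 (Subtype.ext h))] at hu'
  obtain ⟨r, hr⟩ := hu'
  have h1 : u = v * G.projObj e r := by
    rw [← G.projObj_coe_mul, ← G.projObj_coe u]
    exact congrArg _ hr.symm
  rw [h1]
  exact V.smul_mem (MulOpposite.op (G.projObj e r)) hv

theorem isSemisimpleRing_objSubring_of_isGrSemisimple (h : G.IsGrSemisimple) (e : Γ) :
    IsSemisimpleRing (G.objSubring e) := by
  rw [isSemisimpleRing_iff_sSup_simple_right]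
  set T := sSup {n : Submodule (G.objSubring e)ᵐᵒᵖ (G.objSubring e) | IsAtom n}
  have hle : sSup {U : AddSubgroup R | G.IsGrSimple U} ≤ T.toAddSubgroup.comap (G.projObj e) := by
    refine sSup_le fun U hU r hr => ?_
    have hU' : G.IsGrSimple U := hU
    have hr' : G.projObj e r ∈ hU'.prop.1.restrict e :=
      hU'.prop.1.mem_restrict.2 (hU'.prop.1.projObj_mem e hr)
    by_cases h0 : hU'.prop.1.restrict e = ⊥
    · rw [h0, Submodule.mem_bot] at hr'
      change G.projObj e r ∈ T
      rw [hr']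
      exact zero_mem _
    · exact Submodule.mem_sSup_of_mem (hU'.isAtom_restrict h0) hr'
  rw [eq_top_iff]
  intro a _
  rw [← G.projObj_coe a]
  exact hle (h ▸ AddSubgroup.mem_top (a : R))

/-- The ring `R` is nondegenerate if a homogeneous `a` of degree `γ` is zero once `a R_{γ⁻¹} = 0`. -/
def IsNondegenerate : Prop :=
  ∀ {x y : Γ} (γ : x ⟶ y) {a : R}, a ∈ G.component γ →
    (∀ b ∈ G.component (Groupoid.inv γ), a * b = 0) → a = 0

variable {G} in
-- A nonzero homogeneous `a` in a graded right ideal `W ⊆ vR` has range `e`. Nondegeneracy moves it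
-- back to a nonzero `a * b` in `W ∩ V`, so simplicity of `V` gives `v ∈ V ⊆ W`.
theorem IsNondegenerate.isGrSimple_range_mulLeft (hG : G.IsNondegenerate) {e : Γ}
    {V : Submodule (G.objSubring e)ᵐᵒᵖ (G.objSubring e)} (hV : IsAtom V) {v : G.objSubring e}
    (hv : v ∈ V) (hv0 : v ≠ 0) : G.IsGrSimple (AddMonoidHom.mulLeft (v : R)).range := by
  have hvR := G.self_mem_range_mulLeft (𝟙 e) v.2
  refine ⟨⟨G.isGradedRightIdeal_range_mulLeft _ v.2, fun h => hv0 (Subtype.ext ?_)⟩, ?_⟩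
  · rwa [h] at hvR
  rintro W ⟨hW, hW0⟩ hle
  obtain ⟨x, y, γ, a, haW, ha, ha0⟩ := G.exists_homogeneous_ne_zero hW.isGraded hW0
  obtain ⟨r, hr⟩ := hle haW
  rw [AddMonoidHom.coe_mulLeft] at hr
  have hea : G.one e * a = a := by rw [← hr, ← mul_assoc, G.one_mul (𝟙 e) v.2]
  have hy : e = y := by
    by_contra hne
    rw [G.mul_eq_zero (𝟙 e) γ hne (G.one_mem e) ha] at hea
    exact ha0 hea.symm
  subst hy
  obtain ⟨b, hb, hab0⟩ : ∃ b ∈ G.component (Groupoid.inv γ), a * b ≠ 0 := by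
    by_contra! hcon
    exact ha0 (hG γ ha hcon)
  let c : G.objSubring e := ⟨a * b, G.mul_inv_mem ha hb⟩
  have hc : c = v * G.projObj e (r * b) := by
    rw [← G.projObj_coe_mul, ← G.projObj_coe c, ← mul_assoc, hr]
  have hcV : c ∈ V := hc ▸ V.smul_mem (MulOpposite.op (G.projObj e (r * b))) hv
  have hcW : c ∈ hW.restrict e ⊓ V := ⟨hW.mem_restrict.2 (hW.mul_mem_right b haW), hcV⟩
  have hVW : V ≤ hW.restrict e := by
    rcases hV.le_iff.1 (inf_le_right : hW.restrict e ⊓ V ≤ V) with h | h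
    · rw [h, Submodule.mem_bot] at hcW
      exact absurd (congrArg Subtype.val hcW) hab0
    · exact inf_eq_right.1 h
  exact hW.range_mulLeft_le (hW.mem_restrict.1 (hVW hv))

variable {G} in
-- Each `1_e` is a sum of elements `v` of simple right ideals of `R_e`, and each nonzero `v` lies in
-- the gr-simple `vR`.
theorem IsNondegenerate.isGrSemisimple (hG : G.IsNondegenerate)
    (h : ∀ e, IsSemisimpleRing (G.objSubring e)) : G.IsGrSemisimple := by
  refine G.eq_top_of_one_mem (fun {a} r ha => ?_) fun e => ?_
  · have hle : sSup {U : AddSubgroup R | G.IsGrSimple U} ≤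
        (sSup {U : AddSubgroup R | G.IsGrSimple U}).comap (AddMonoidHom.mulRight r) :=
      sSup_le fun U (hU : G.IsGrSimple U) b hb =>
        AddSubgroup.mem_sSup_of_mem hU (hU.prop.1.mul_mem_right r hb)
    exact hle ha
  · set T := sSup {U : AddSubgroup R | G.IsGrSimple U}
    have h1 := isSemisimpleRing_iff_sSup_simple_right.1 (h e)
    have hmem : (1 : G.objSubring e) ∈
        sSup {n : Submodule (G.objSubring e)ᵐᵒᵖ (G.objSubring e) | IsAtom n} := by
      rw [h1]; trivial
    rw [sSup_eq_iSup'] at hmem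
    refine Submodule.iSup_induction _ (motive := fun a : G.objSubring e => (a : R) ∈ T) hmem ?_
      (zero_mem T) (fun _ _ => add_mem)
    rintro ⟨V, hV⟩ v hv
    by_cases hv0 : v = 0
    · rw [hv0]; exact zero_mem T
    · exact AddSubgroup.mem_sSup_of_mem (hG.isGrSimple_range_mulLeft hV hv hv0)
        (G.self_mem_range_mulLeft (𝟙 e) v.2)

end Semisimple

/-! ### The graded radical computed in the rings `R_e`. -/

section Radical

/-- The largest graded right ideal of `R` whose intersection with `R_e` lies in `n`. -/
def induced (e : Γ) (n : Submodule (G.objSubring e)ᵐᵒᵖ (G.objSubring e)) : AddSubgroup R where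
  carrier := {a | ∀ r, G.projObj e (a * r) ∈ n}
  zero_mem' r := by simp
  add_mem' ha hb r := by rw [add_mul, map_add]; exact add_mem (ha r) (hb r)
  neg_mem' ha r := by rw [neg_mul, map_neg]; exact neg_mem (ha r)

theorem isGradedRightIdeal_induced (e : Γ)
    (n : Submodule (G.objSubring e)ᵐᵒᵖ (G.objSubring e)) :
    G.IsGradedRightIdeal (G.induced e n) := by
  refine ⟨fun {a} r ha s => by rw [mul_assoc]; exact ha _, G.isGraded_iff.2 ?_⟩
  rintro ⟨x, y, γ⟩ a ha r
  have hp : G.proj ⟨x, y, γ⟩ a ∈ G.component γ := G.proj_mem ⟨x, y, γ⟩ a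
  by_cases hy : y = e
  · subst hy
    -- Testing `a` against only the degree `γ⁻¹` part of `r` isolates the component of `a` of degree
    -- `γ`.
    have h1 := ha (G.proj ⟨y, x, Groupoid.inv γ⟩ r)
    have h2 : G.projObj y (G.proj ⟨x, y, γ⟩ a * r) =
        G.projObj y (a * G.proj ⟨y, x, Groupoid.inv γ⟩ r) := by
      refine Subtype.ext ?_
      rw [G.coe_projObj_mul hp, G.proj_mul (Groupoid.inv γ) (G.proj_mem ⟨y, x, Groupoid.inv γ⟩ r),
        coe_projObj, Groupoid.inv_comp]
    rwa [h2]
  · rw [G.projObj_mul_of_ne hy hp]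
    exact zero_mem _

theorem mem_induced_of_mem {e : Γ} {n : Submodule (G.objSubring e)ᵐᵒᵖ (G.objSubring e)}
    {a : G.objSubring e} (ha : a ∈ n) : (a : R) ∈ G.induced e n := fun r => by
  rw [G.projObj_coe_mul]
  exact n.smul_mem (MulOpposite.op (G.projObj e r)) ha

/-- A graded right ideal strictly above the induced one meets `R_e` strictly above `n`, hence
contains `1_e`. -/
theorem isGrMaximal_induced {e : Γ} {n : Submodule (G.objSubring e)ᵐᵒᵖ (G.objSubring e)}
    (hn : IsCoatom n) : G.IsGrMaximal (G.induced e n) := by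
  refine ⟨⟨G.isGradedRightIdeal_induced e n, fun h => one_notMem_of_isCoatom hn ?_⟩, ?_⟩
  · have h1 : G.one e ∈ G.induced e n := h ▸ AddSubgroup.mem_top _
    have h2 := h1 (G.one e)
    rwa [G.one_mul_one, ← G.objSubring_coe_one, G.projObj_coe] at h2
  · rintro W ⟨hW, hWtop⟩ hle a ha r
    by_contra hcon
    have hc : G.projObj e (a * r) ∈ hW.restrict e :=
      hW.mem_restrict.2 (hW.projObj_mem e (hW.mul_mem_right r ha))
    have hnW : n ≤ hW.restrict e := fun b hb => 
      hW.mem_restrict.2 (hle (G.mem_induced_of_mem hb))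
    have htop : hW.restrict e = ⊤ := hn.2 _ (lt_of_le_of_ne hnW fun h => hcon (h ▸ hc))
    have hone : G.one e ∈ W :=
      hW.mem_restrict.1 (by rw [htop]; trivial : (1 : G.objSubring e) ∈ hW.restrict e)
    refine hWtop (eq_top_iff.2 fun b _ => ?_)
    -- Elements killed by `1_e` on the left have no multiples with a component in `R_e`, so they
    -- already lie in the induced ideal.
    have hb : b - G.one e * b ∈ W := hle fun s => by
      rw [sub_mul, map_sub, mul_assoc, G.projObj_one_mul, sub_self]
      exact zero_mem _
    simpa using add_mem hb (hW.mul_mem_right b hone)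

/-- A homogeneous element `a` of degree `γ` is in the graded Jacobson radical iff `a R_{γ⁻¹}` is
contained in the Jacobson radical of `R_{r(γ)}`. -/
theorem mem_grRadSubgroup_iff {x y : Γ} {γ : x ⟶ y} {a : R} (ha : a ∈ G.component γ) :
    a ∈ G.grRadSubgroup ↔ ∀ (b : R) (hb : b ∈ G.component (Groupoid.inv γ)),
      (⟨a * b, G.mul_inv_mem ha hb⟩ : G.objSubring y) ∈ Ring.jacobson (G.objSubring y) := by
  simp only [grRadSubgroup, AddSubgroup.mem_sInf]
  constructor
  · intro h b hb
    rw [mem_ringJacobson_iff_forall_isCoatom_right]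
    intro n hn
    have h1 := h _ (G.isGrMaximal_induced hn) b
    have h2 := G.projObj_coe (⟨a * b, G.mul_inv_mem ha hb⟩ : G.objSubring y)
    rwa [← h2]
  · intro h W (hW : G.IsGrMaximal W)
    by_contra haW
    have htop : W ⊔ (AddMonoidHom.mulLeft a).range = ⊤ := by
      by_contra hne
      have := hW.le_of_ge ⟨G.isGradedRightIdeal_sup_mul hW.prop.1 γ ha, hne⟩ le_sup_left
      exact haW (this (AddSubgroup.mem_sup_right (G.self_mem_range_mulLeft γ ha)))
    have h1 : G.one y ∈ W ⊔ (AddMonoidHom.mulLeft a).range := htop ▸ AddSubgroup.mem_top _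
    obtain ⟨m, hm, _, ⟨s, rfl⟩, hms⟩ := AddSubgroup.mem_sup.1 h1
    rw [AddMonoidHom.coe_mulLeft] at hms
    have hj := h _ (G.proj_mem ⟨y, x, Groupoid.inv γ⟩ s)
    obtain ⟨u, hu⟩ := exists_mul_eq_one_of_mem_ringJacobson hj
    -- Taking `R_y`-components in `1_y = m + a * s` leaves only the degree `γ⁻¹` part of `s`. So the
    -- component of `m`, which is in `W`, is `1` minus a radical element, hence right invertible;
    -- then `1_y ∈ W`.
    have h2 : G.projObj y m = 1 - ⟨_, G.mul_inv_mem ha (G.proj_mem ⟨y, x, Groupoid.inv γ⟩ s)⟩ := by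
      rw [eq_sub_of_add_eq hms, map_sub, ← G.objSubring_coe_one, G.projObj_coe]
      congr 1
      exact Subtype.ext (G.coe_projObj_mul ha s)
    rw [← h2] at hu
    have h3 : G.one y ∈ W := by
      rw [← G.objSubring_coe_one, ← hu]
      exact hW.prop.1.mul_mem_right _ (hW.prop.1.projObj_mem y hm)
    exact haW (G.one_mul γ ha ▸ hW.prop.1.mul_mem_right a h3)

theorem mem_grRad_iff {a : R} : a ∈ G.grRad ↔ a ∈ G.grRadSubgroup := by
  rw [grRad, TwoSidedIdeal.mem_mk', SetLike.mem_coe]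

theorem coe_mem_grRadSubgroup_iff {e : Γ} (a : G.objSubring e) :
    (a : R) ∈ G.grRadSubgroup ↔ a ∈ Ring.jacobson (G.objSubring e) := by
  have hinv : Groupoid.inv (𝟙 e) = 𝟙 e := by simp
  rw [G.mem_grRadSubgroup_iff a.2]
  constructor
  · intro h
    have := h (G.one e) (by rw [hinv]; exact G.one_mem e)
    convert this using 1
    exact Subtype.ext (G.mul_one (𝟙 e) a.2).symm
  · intro h b hb
    rw [hinv] at hb
    exact Ideal.mul_mem_right (⟨b, hb⟩ : G.objSubring e) _ h

end Radical

/-! ### Passing to the quotient by the graded radical. -/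

section Semilocal

/-- The quotient of `R` by its graded Jacobson radical. -/
abbrev radQuotient : GroupoidGrading Γ G.grRad.ringCon.Quotient :=
  G.quotient G.grRad G.isGradedIdeal_grRad

theorem quotientMap_eq_zero_iff {I : TwoSidedIdeal R} {a : R} : quotientMap I a = 0 ↔ a ∈ I := by
  rw [← map_zero (quotientMap I), quotientMap_eq_iff, sub_zero]

/-- The ring homomorphism `R_e → (R/rad^gr(R))_e`. -/
def objQuotientMap (e : Γ) : G.objSubring e →+* G.radQuotient.objSubring e where
  toFun a := ⟨quotientMap G.grRad a, a, a.2, rfl⟩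
  map_zero' := rfl
  map_one' := rfl
  map_add' _ _ := rfl
  map_mul' _ _ := rfl

theorem objQuotientMap_surjective (e : Γ) : Function.Surjective (G.objQuotientMap e) := by
  rintro ⟨_, a, ha, rfl⟩
  exact ⟨⟨a, ha⟩, rfl⟩

theorem ker_objQuotientMap (e : Γ) :
    RingHom.ker (G.objQuotientMap e) = Ring.jacobson (G.objSubring e) := by
  ext a
  rw [RingHom.mem_ker, ← G.coe_mem_grRadSubgroup_iff, ← mem_grRad_iff, ← quotientMap_eq_zero_iff]
  exact Subtype.ext_iff

theorem isSemisimpleRing_radQuotient_objSubring_iff (e : Γ) :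
    IsSemisimpleRing (G.radQuotient.objSubring e) ↔ IsSemilocalRing (G.objSubring e) := by
  rw [IsSemilocalRing]
  exact ((Ideal.quotEquivOfEq (G.ker_objQuotientMap e).symm).trans
    (RingHom.quotientKerEquivOfSurjective (G.objQuotientMap_surjective e))).isSemisimpleRing_iff.symm

/-- If `a R_{γ⁻¹}` lies in the graded radical, it lies in `rad(R_y)`, and the criterion for
homogeneous elements puts `a` in the graded radical. -/
theorem isNondegenerate_radQuotient : G.radQuotient.IsNondegenerate := by
  rintro x y γ _ ⟨a, ha, rfl⟩ h
  rw [quotientMap_eq_zero_iff, mem_grRad_iff, G.mem_grRadSubgroup_iff ha]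
  intro b hb
  rw [← G.coe_mem_grRadSubgroup_iff, ← mem_grRad_iff, ← quotientMap_eq_zero_iff]
  exact h _ ⟨b, hb, rfl⟩

theorem isGrSemilocal_iff : G.IsGrSemilocal ↔ ∀ e, IsSemilocalRing (G.objSubring e) := by
  simp only [← isSemisimpleRing_radQuotient_objSubring_iff]
  exact ⟨G.radQuotient.isSemisimpleRing_objSubring_of_isGrSemisimple,
    IsNondegenerate.isGrSemisimple G.isNondegenerate_radQuotient⟩

end Semilocal

/-! ### Object rings of the corners and the conclusion. -/

section Corner

/-- The ring `(1_e R 1_e)_e` is `R_e`. -/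
def cornerObjSubringEquiv (e : Γ) : (G.corner e).objSubring e ≃+* G.objSubring e where
  toFun a := ⟨a.1.1, a.2⟩
  invFun a := ⟨⟨a, G.mem_corner_iff.2 ⟨G.one_mul (𝟙 e) a.2, G.mul_one (𝟙 e) a.2⟩⟩, a.2⟩
  left_inv _ := rfl
  right_inv _ := rfl
  map_add' _ _ := rfl
  map_mul' _ _ := rfl

theorem subsingleton_corner_objSubring {e f : Γ} (h : f ≠ e) :
    Subsingleton ((G.corner e).objSubring f) := by
  refine subsingleton_of_zero_eq_one (Subtype.ext ?_)
  change (0 : NonUnitalRing.corner (G.one e)) = (G.corner e).one f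
  exact (if_neg h).symm

end Corner

end GroupoidGrading

theorem isSemilocalRing_of_subsingleton (A : Type*) [Ring A] [Subsingleton A] :
    IsSemilocalRing A :=
  have : Subsingleton (A ⧸ Ring.jacobson A) := Quotient.instSubsingletonQuotient _
  inferInstanceAs (IsSemisimpleModule _ _)

theorem RingEquiv.isSemilocalRing_iff {A B : Type*} [Ring A] [Ring B] (f : A ≃+* B) :
    IsSemilocalRing A ↔ IsSemilocalRing B := by
  have h : (Ring.jacobson B) = (Ring.jacobson A).map (f : A →+* B) := by
    rw [← Ideal.jacobson_bot, ← Ideal.jacobson_bot, Ideal.map_jacobson_of_bijective f.bijective,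
      Ideal.map_bot]
  exact (Ideal.quotientEquiv _ _ f h).isSemisimpleRing_iff

theorem mainTheorem3 {Γ : Type u} [Groupoid.{v} Γ] {R : Type w} [NonUnitalRing R]
    (G : GroupoidGrading Γ R) :
    List.TFAE [
      G.IsGrSemilocal,
      ∀ e : Γ, (G.corner e).IsGrSemilocal,
      ∀ e : Γ, IsSemilocalRing (G.objSubring e)] := by
  have h13 := G.isGrSemilocal_iff
  have h23 : (∀ e : Γ, (G.corner e).IsGrSemilocal) ↔
      ∀ e : Γ, IsSemilocalRing (G.objSubring e) := by
    refine forall_congr' fun e => ?_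
    -- In the corner at `e`, only the object ring at `e` imposes a condition; the others are zero.
    rw [GroupoidGrading.isGrSemilocal_iff, ← (G.cornerObjSubringEquiv e).isSemilocalRing_iff]
    refine ⟨fun h => h e, fun h f => ?_⟩
    by_cases hf : f = e
    · exact hf ▸ h
    · have := G.subsingleton_corner_objSubring hf
      exact isSemilocalRing_of_subsingleton _
  tfae_have 1 ↔ 3 := h13
  tfae_have 2 ↔ 3 := h23
  tfae_finish
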